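/- Let $q$ be a power of a prime $p$, $A=\mathbb{F}_q[T]$ with set of monic elements $A_+$, $K=\mathbb{F}_q(T)$, $K_\infty$ the completion of $K$ at the place $1/T$, and $\mathbb{C}_\infty$ the completion of an algebraic closure of $K_\infty$. Let $\rho$ be the Carlitz module, $\rho_T(X)=TX+X^q$, and let $\widetilde\pi\in\mathbb{C}_\infty^\times$ be a period of it, i.e. the function $e_{\widetilde\pi A}(z)=z\prod_{0\neq\lambda\in\widetilde\pi A}(1-z/\lambda)$ satisfies $e_{\widetilde\pi A}(az)=\rho_a(e_{\widetilde\pi A}(z))$ for all $a\in A$. Let $G_n(X)\in\mathbb{C}_\infty[X]$ be the $n$-th Goss polynomial of the lattice $\widetilde\pi A$, characterized by $\sum_{\lambda\in\widetilde\pi A}(z-\lambda)^{-n}=G_n\bigl(1/e_{\widetilde\pi A}(z)\bigr)$ for $z\notin\widetilde\pi A$. For $a\in A_+$ of degree $d$ let $$t_a=\frac{t^{q^d}}{\rho_a(t^{-1})\,t^{q^d}}=t^{q^d}+\cdots\in\mathbb{C}_\infty[[t]],$$ which is the expansion of $t(az)$ in $t=t(z)=1/e_{\widetilde\pi A}(\widetilde\pi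 z)$. Let $k,n$ be positive integers such that $k-2n$ is a positive multiple of $q-1$ and $n\le p^{\nu_0}$, where $\nu_0=v_p(k-n)$. For $l\ge 0$ let $$F_{k,n,l}=\sum_{a\in A_+}a^{(k-n)q^l}\,G_n(t_a)\in\mathbb{C}_\infty[[t]].$$ **Theorem.** Let $\nu\ge 0$ be an integer and let $\mathfrak{p}$ be a non-zero prime ideal of $A$ of degree $d>\log_q n$. Then $$F_{k,n,d+\nu}\equiv F_{k,n,\nu}\pmod{\mathfrak{p}^{q^\nu p^{\nu_0}}}$$ as a congruence of $t$-expansion coefficients: for every $m\ge0$ the coefficients of $t^m$ in $F_{k,n,d+\nu}$ and in $F_{k,n,\nu}$ lie in the localization $A_{\mathfrak p}\subset K$, and their difference lies in $\mathfrak{p}^{q^\nu p^{\nu_0}}A_{\mathfrak p}$. -/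

import Mathlib

open Polynomial
open scoped NNReal WithZero

noncomputable section

namespace Drinfeld

/-! ### The field `C` : completion of an algebraic closure of `K_∞` -/

section Fields

variable (F : Type*) [Field F]

open Classical in
/-- `K_∞`, the completion of `K = F(T)` at the place `1/T`. -/
def KInfty : Type _ := RatFunc.CompletionAtInfty F

open Classical in
instance : Field (KInfty F) := inferInstanceAs (Field (RatFunc.CompletionAtInfty F))

open Classical in
instance : Algebra (RatFunc F) (KInfty F) :=
  inferInstanceAs (Algebra (RatFunc F) (RatFunc.CompletionAtInfty F))

open Classical in
instance : Valued (KInfty F) ℤᵐ⁰ :=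
  inferInstanceAs (Valued (RatFunc.CompletionAtInfty F) ℤᵐ⁰)

open Classical in
instance : CompleteSpace (KInfty F) :=
  letI : UniformSpace (RatFunc F) := (RatFunc.inftyValued F).toUniformSpace
  inferInstanceAs (CompleteSpace (UniformSpace.Completion (RatFunc F)))

open Classical in
theorem KInfty.valued_algebraMap (x : RatFunc F) :
    Valued.v (algebraMap (RatFunc F) (KInfty F) x) = RatFunc.inftyValuationDef F x :=
  letI : Valued (RatFunc F) ℤᵐ⁰ := RatFunc.inftyValued F
  Valued.extensionValuation_apply_coe x

theorem KInfty.valued_T :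
    Valued.v (algebraMap (RatFunc F) (KInfty F) RatFunc.X) = WithZero.exp (1 : ℤ) := by
  classical
  rw [KInfty.valued_algebraMap]
  exact RatFunc.inftyValuation.X F

variable [Fintype F]

/-- The absolute value on `K_∞` is normalised by `|T| = q`. -/
instance : (Valued.v : Valuation (KInfty F) ℤᵐ⁰).RankOne where
  hom' := (WithZeroMulInt.toNNReal
    (e := (Fintype.card F : ℝ≥0)) (by exact_mod_cast Fintype.card_ne_zero)).comp
      MonoidWithZeroHom.ValueGroup₀.embedding
  strictMono' := (WithZeroMulInt.toNNReal_strictMono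
    (by exact_mod_cast Fintype.one_lt_card)).comp
      MonoidWithZeroHom.ValueGroup₀.embedding_strictMono
  exists_val_nontrivial := ⟨algebraMap (RatFunc F) (KInfty F) RatFunc.X, by
    rw [KInfty.valued_T]; exact ⟨by simp, by simp⟩⟩

instance : NontriviallyNormedField (KInfty F) := Valued.toNontriviallyNormedField (KInfty F) ℤᵐ⁰

instance : IsUltrametricDist (KInfty F) :=
  inferInstanceAs (@IsUltrametricDist (KInfty F)
    (Valued.toNormedField (KInfty F) ℤᵐ⁰).toMetricSpace.toDist)

/-- An algebraic closure of `K_∞`, with the unique extension of the absolute value. -/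
def KInftyAlgCl : Type _ := AlgebraicClosure (KInfty F)

instance : Field (KInftyAlgCl F) := inferInstanceAs (Field (AlgebraicClosure (KInfty F)))

instance : Algebra (KInfty F) (KInftyAlgCl F) :=
  inferInstanceAs (Algebra (KInfty F) (AlgebraicClosure (KInfty F)))

instance : IsAlgClosure (KInfty F) (KInftyAlgCl F) :=
  inferInstanceAs (IsAlgClosure (KInfty F) (AlgebraicClosure (KInfty F)))

instance : Algebra.IsAlgebraic (KInfty F) (KInftyAlgCl F) := IsAlgClosure.isAlgebraic

instance : NontriviallyNormedField (KInftyAlgCl F) :=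
  spectralNorm.nontriviallyNormedField (KInfty F) (KInftyAlgCl F)

/-- The completion of the algebraic closure of `K_∞`. -/
abbrev CInfty : Type _ := UniformSpace.Completion (KInftyAlgCl F)

/-- The inclusion `A = F[T] ⊆ K ⊆ K_∞ ⊆ C`. -/
def ofA : F[X] →+* CInfty F :=
  (UniformSpace.Completion.coeRingHom (α := KInftyAlgCl F)).comp
    ((algebraMap (KInfty F) (KInftyAlgCl F)).comp
      ((algebraMap (RatFunc F) (KInfty F)).comp (algebraMap F[X] (RatFunc F))))

end Fields

/-! ### Lattices and Goss polynomials -/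

section Lattice

variable {C : Type*} [NormedField C]

/-- The exponential function `e_Λ(z) = z ∏_{0 ≠ λ ∈ Λ} (1 - z / λ)` of a lattice `Λ`. -/
def latticeExp (Λ : Set C) (z : C) : C :=
  z * ∏' l : {l : C // l ∈ Λ ∧ l ≠ 0}, (1 - z / (l : C))

/-- `G` is the `n`-th Goss polynomial of the lattice `Λ`:
`∑_{λ ∈ Λ} (z - λ)⁻ⁿ = G (1 / e_Λ(z))` for all `z ∉ Λ`. -/
def IsGossPolynomial (Λ : Set C) (n : ℕ) (G : C[X]) : Prop :=
  ∀ z ∉ Λ, HasSum (fun l : Λ => ((z - (l : C)) ^ n)⁻¹) (G.eval (latticeExp Λ z)⁻¹)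

open Classical in
/-- The `n`-th Goss polynomial `G_{n,Λ}(X)` of the lattice `Λ`. -/
def gossPolynomial (Λ : Set C) (n : ℕ) : C[X] :=
  if h : ∃ G : C[X], IsGossPolynomial Λ n G then h.choose else 0

end Lattice

/-! ### The Carlitz module -/

section Carlitz

variable (F : Type*) [Field F] [Fintype F]

/-- `ρ_{T^i}(X)`, as a polynomial over `A = F[T]`; here `ρ_T(X) = T X + X^q`. -/
def carlitzTPow : ℕ → F[X][X]
  | 0 => X
  | i + 1 => C X * carlitzTPow i + carlitzTPow i ^ Fintype.card F

variable {F}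

/-- `ρ_a(X) = ∑ aᵢ ρ_{T^i}(X)` for `a = ∑ aᵢ T^i`. -/
def carlitz (a : F[X]) : F[X][X] :=
  a.sum fun i c => C (C c) * carlitzTPow F i

/-- `ρ_a(X)` as a polynomial over `C`. -/
def carlitzC (a : F[X]) : (CInfty F)[X] := (carlitz a).map (ofA F)

/-- The rank one lattice `π A`. -/
def periodLattice (π : CInfty F) : Set (CInfty F) := Set.range fun a : F[X] => π * ofA F a

/-- `π` is a period of the Carlitz module: `π A` is the lattice that uniformises `ρ`, i.e.
`e_{π A}` is the Carlitz exponential, `e_{π A}(a z) = ρ_a(e_{π A}(z))`. -/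
def IsCarlitzPeriod (π : CInfty F) : Prop :=
  π ≠ 0 ∧ ∀ (a : F[X]) (z : CInfty F),
    latticeExp (periodLattice π) (ofA F a * z) =
      (carlitzC a).eval (latticeExp (periodLattice π) z)

/-- `G_n(X) = G_{n, π A}(X)`. -/
def goss (π : CInfty F) (n : ℕ) : (CInfty F)[X] := gossPolynomial (periodLattice π) n

/-- The `t`-expansion of `t_a = t(az)` for monic `a` of degree `d`:
`t_a = t^{q^d} / (ρ_a(t⁻¹) t^{q^d})`. -/
def tExp (a : F[X]) : PowerSeries (CInfty F) :=
  PowerSeries.X ^ (Fintype.card F ^ a.natDegree) *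
    (((carlitzC a).reflect (Fintype.card F ^ a.natDegree) : (CInfty F)[X]) :
      PowerSeries (CInfty F))⁻¹

/-- The formal series `f_{k,n} = ∑_{a ∈ A₊} a^{k-n} G_n(t_a) ∈ C[[t]]`. As `t^{q^{deg a}}` divides
`G_n(t_a)` for `n ≥ 1`, only finitely many `a` contribute to a given coefficient. -/
def fSeries (π : CInfty F) (k n : ℕ) : PowerSeries (CInfty F) :=
  PowerSeries.mk fun m => ∑ᶠ a : {a : F[X] // a.Monic},
    ofA F (a : F[X]) ^ (k - n) * PowerSeries.coeff m (aeval (tExp (a : F[X])) (goss π n))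

/-- `F_{k,n,l} = f_{(k-n)q^l+n, n} = ∑_{a ∈ A₊} a^{(k-n)q^l} G_n(t_a)`. -/
def FSeries (π : CInfty F) (k n l : ℕ) : PowerSeries (CInfty F) :=
  fSeries π ((k - n) * Fintype.card F ^ l + n) n

/-- The subset `𝔭^N A_𝔭` of `C`: the fractions `x / s` with `x ∈ 𝔭^N` and `s ∈ A ∖ 𝔭`.
For `N = 0` it is the localisation `A_𝔭`. -/
def localPow (𝔭 : Ideal F[X]) (N : ℕ) : Set (CInfty F) :=
  {c | ∃ x ∈ 𝔭 ^ N, ∃ s ∉ 𝔭, c = ofA F x / ofA F s}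

/-- `f ≡ g mod 𝔭^N` for `t`-expansions: both have `𝔭`-integral coefficients, and the differences of
corresponding coefficients lie in `𝔭^N A_𝔭`. -/
def CongrMod (𝔭 : Ideal F[X]) (N : ℕ) (f g : PowerSeries (CInfty F)) : Prop :=
  ∀ m, PowerSeries.coeff m f ∈ localPow 𝔭 0 ∧ PowerSeries.coeff m g ∈ localPow 𝔭 0 ∧
    PowerSeries.coeff m f - PowerSeries.coeff m g ∈ localPow 𝔭 N

end Carlitz

end Drinfeld

end

/-! Coefficientwise, the difference of the two series is a finite sum over monic `a` of
`a^{(k-n)q^{d+ν}} - a^{(k-n)q^ν}` times a coefficient of `G_n(t_a)`. The first factor supplies the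
power of `𝔭 = (P)`: `a^{q^d} ≡ a` mod `P`, and writing `k - n = p^{ν₀} m`, the Frobenius power `q^ν
p^{ν₀}` raises the congruence of `m`-th powers to one modulo `P^{q^ν p^{ν₀}}`
(`pow_sub_pow_mem_span_pow`).

It remains to see that the second factor is `𝔭`-integral. The series `t_a` lies in `A[[t]]`, since
`ρ_a` has leading coefficient 1 (`exists_map_ofA_eq_tExp`). For `G_n`, the generating function `∑
G_n(X) u^{n-1} = X / (1 - X e_C(u))` shows that only coefficients `1/D_i` of the Carlitz exponential
with `q^i < n` occur; then `i < d`, and `D_i` is a product of powers of `T^{q^j} - T` with `0 < j <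
d`, none divisible by `P`.

Most of the work is this generating function for the analytically defined `G_n`
(`goss_eq_gossFormula`). For the finite lattice `{π a | deg a < N}` it is a logarithmic derivative
identity, since its exponential `e_N` is `F`-linear with derivative 1. As `N → ∞`, the coefficients
of `e_N` tend to `1/D_i` (`tendsto_expCoeff`), and a Goss polynomial is determined by its values. -/

open Polynomial Filter Topology
open scoped NNReal WithZero

noncomputable section

/-! ### Infinite products and recursions over ultrametric fields -/

section Ultrametric

variable {K : Type*} [NormedField K] [IsUltrametricDist K]

theorem norm_prod_one_add_sub_one_le {ι : Type*} (s : Finset ι) (f : ι → K) {ε : ℝ}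
    (hε : 0 ≤ ε) (hε1 : ε ≤ 1) (hf : ∀ i ∈ s, ‖f i‖ ≤ ε) :
    ‖∏ i ∈ s, (1 + f i) - 1‖ ≤ ε := by
  classical
  induction s using Finset.induction_on with
  | empty => simpa
  | insert a s ha ih =>
    rw [Finset.prod_insert ha]
    have h1 := ih fun i hi => hf i (Finset.mem_insert_of_mem hi)
    have h2 := hf a (Finset.mem_insert_self a s)
    have h3 : ‖1 + f a‖ ≤ 1 := (IsUltrametricDist.norm_add_le_max _ _).trans
      (max_le (by simp) (h2.trans hε1))
    have : (1 + f a) * ∏ i ∈ s, (1 + f i) - 1 =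
        (1 + f a) * (∏ i ∈ s, (1 + f i) - 1) + f a := by ring
    rw [this]
    refine (IsUltrametricDist.norm_add_le_max _ _).trans (max_le ?_ h2)
    rw [norm_mul]
    exact (mul_le_of_le_one_left (norm_nonneg _) h3).trans h1

theorem norm_one_add_eq_one {x : K} (hx : ‖x‖ < 1) : ‖1 + x‖ = 1 := by
  rw [IsUltrametricDist.norm_add_eq_max_of_norm_ne_norm (by simpa using hx.ne')]
  simpa using hx.le

/-- Factors with `‖f i‖ < 1` have norm 1, so partial products have constant norm from `s₁` on; later
factors multiply them by something close to 1, which gives the Cauchy property. -/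
theorem multipliable_one_add_of_tendsto_cofinite_zero [CompleteSpace K] {ι : Type*} {f : ι → K}
    (hf : Tendsto f cofinite (𝓝 0)) : Multipliable fun i => 1 + f i := by
  classical
  have small : ∀ ε > 0, ∃ s : Finset ι, ∀ i ∉ s, ‖f i‖ < ε := fun ε hε => by
    have h := (Metric.tendsto_nhds.1 hf ε hε)
    rw [eventually_cofinite] at h
    exact ⟨h.toFinset, fun i hi => by simpa using hi⟩
  obtain ⟨s₁, hs₁⟩ := small 1 one_pos
  suffices h : CauchySeq fun s : Finset ι => ∏ i ∈ s, (1 + f i) by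
    obtain ⟨a, ha⟩ := cauchySeq_tendsto_of_complete h
    exact ⟨a, by simpa [HasProd] using ha⟩
  rw [Metric.cauchySeq_iff']
  intro ε hε
  set B := ‖∏ i ∈ s₁, (1 + f i)‖ with hB
  have hB0 : 0 ≤ B := norm_nonneg _
  set δ := min (1 / 2) (ε / (2 * (B + 1))) with hδ
  have hδ0 : 0 < δ := by positivity
  obtain ⟨s₂, hs₂⟩ := small δ hδ0
  refine ⟨s₁ ∪ s₂, fun s hs => ?_⟩
  have h1 : ‖∏ i ∈ s₁ ∪ s₂, (1 + f i)‖ = B := by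
    rw [← Finset.prod_sdiff (Finset.subset_union_left : s₁ ⊆ s₁ ∪ s₂), norm_mul, norm_prod,
      Finset.prod_eq_one, one_mul]
    exact fun i hi => norm_one_add_eq_one (hs₁ i (Finset.mem_sdiff.1 hi).2)
  have h2 : ‖∏ i ∈ s \ (s₁ ∪ s₂), (1 + f i) - 1‖ ≤ δ := by
    refine norm_prod_one_add_sub_one_le _ _ hδ0.le ((min_le_left _ _).trans (by norm_num)) ?_
    intro i hi
    refine (hs₂ i fun h => (Finset.mem_sdiff.1 hi).2 (Finset.mem_union_right _ h)).le
  have h3 : δ * (2 * (B + 1)) ≤ ε := by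
    rw [← le_div_iff₀ (by positivity)]
    exact min_le_right _ _
  rw [dist_eq_norm, ← Finset.prod_sdiff hs, ← sub_one_mul, norm_mul, h1]
  have h4 := mul_le_mul_of_nonneg_right h2 hB0
  nlinarith

/-- A contracting affine recursion with convergent inhomogeneous terms converges. -/
theorem tendsto_of_contracting_recursion {x s : ℕ → K} {r l : K} (hr : ‖r‖ < 1)
    (hs : Tendsto s atTop (𝓝 ((1 - r) * l))) (hx : ∀ N, x (N + 1) = r * x N + s N) :
    Tendsto x atTop (𝓝 l) := by
  rw [Metric.tendsto_atTop]
  intro ε hε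
  obtain ⟨M, hM⟩ := Metric.tendsto_atTop.1 hs ε hε
  -- The ultrametric inequality gives a dichotomy: the error has decayed geometrically so far, or it
  -- has dropped below `ε` and stays there.
  have key : ∀ j, ‖x (M + j) - l‖ ≤ ‖r‖ ^ j * ‖x M - l‖ ∨
      ‖x (M + j) - l‖ < ε := by
    intro j
    induction j with
    | zero => left; simp
    | succ j ih =>
      have e : x (M + (j + 1)) - l = r * (x (M + j) - l) + (s (M + j) - (1 - r) * l) := by
        rw [← add_assoc, hx]; ring
      have hj := hM (M + j) (Nat.le_add_right _ _)
      rw [dist_eq_norm] at hj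
      have h := IsUltrametricDist.norm_add_le_max (r * (x (M + j) - l))
        (s (M + j) - (1 - r) * l)
      rw [← e, norm_mul] at h
      rcases le_max_iff.1 h with h | h
      · rcases ih with ih | ih
        · left
          rw [pow_succ', mul_assoc]
          exact h.trans (mul_le_mul_of_nonneg_left ih (norm_nonneg _))
        · right
          exact (h.trans (mul_le_of_le_one_left (norm_nonneg _) hr.le)).trans_lt ih
      · exact Or.inr (h.trans_lt hj)
  have h0 : Tendsto (fun j => ‖r‖ ^ j * ‖x M - l‖) atTop (𝓝 0) := by
    simpa using (tendsto_pow_atTop_nhds_zero_of_lt_one (norm_nonneg r) hr).mul_const ‖x M - l‖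
  obtain ⟨J, hJ⟩ := (h0.eventually (gt_mem_nhds hε)).exists_forall_of_atTop
  refine ⟨M + J, fun n hn => ?_⟩
  obtain ⟨j, rfl⟩ := Nat.exists_eq_add_of_le ((Nat.le_add_right M J).trans hn)
  rw [dist_eq_norm]
  rcases key j with h | h
  · exact h.trans_lt (hJ j (by omega))
  · exact h

end Ultrametric

/-! ### The absolute value on `A` and exhaustion by degree -/

namespace Drinfeld

variable {F : Type*} [Field F] [Fintype F]

theorem norm_ofA_C {c : F} (hc : c ≠ 0) : ‖ofA F (C c)‖ = 1 := by
  have h : ‖ofA F (C c)‖ ^ (Fintype.card F - 1) = 1 := by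
    rw [← norm_pow, ← map_pow, ← map_pow, FiniteField.pow_card_sub_one_eq_one c hc]
    simp
  exact (pow_eq_one_iff_of_nonneg (norm_nonneg _)
    (Nat.sub_ne_zero_of_lt Fintype.one_lt_card)).1 h

theorem norm_ofA_C_le (c : F) : ‖ofA F (C c)‖ ≤ 1 := by
  rcases eq_or_ne c 0 with rfl | hc
  · simp
  · exact (norm_ofA_C hc).le

/-- Natural numbers are images of constants in `F`, which are 0 or roots of unity and so have norm
at most 1. -/
instance : IsUltrametricDist (CInfty F) :=
  IsUltrametricDist.isUltrametricDist_of_forall_norm_natCast_le_one fun n => by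
    have h := norm_ofA_C_le (n : F)
    rwa [map_natCast, map_natCast] at h

theorem one_lt_norm_ofA_X : 1 < ‖ofA F X‖ := by
  have h1 : ‖ofA F X‖ = ‖algebraMap (RatFunc F) (KInfty F) RatFunc.X‖ := by
    have : ofA F X = ((algebraMap (KInfty F) (KInftyAlgCl F)
        (algebraMap (RatFunc F) (KInfty F) RatFunc.X) : KInftyAlgCl F) : CInfty F) := by
      simp only [ofA, RingHom.comp_apply, RatFunc.algebraMap_X]
      rfl
    rw [this, UniformSpace.Completion.norm_coe]
    exact spectralNorm_extends _
  rw [h1]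
  refine (Valued.toNormedField.one_lt_norm_iff (L := KInfty F) (Γ₀ := ℤᵐ⁰)).2 ?_
  rw [KInfty.valued_T]
  exact (WithZero.exp_lt_exp (a := 0) (b := 1)).2 one_pos

theorem norm_ofA {a : F[X]} (ha : a ≠ 0) : ‖ofA F a‖ = ‖ofA F X‖ ^ a.natDegree := by
  induction h : a.natDegree generalizing a with
  | zero =>
    obtain ⟨c, rfl⟩ := natDegree_eq_zero.1 h
    rw [norm_ofA_C (by simpa using ha), pow_zero]
  | succ n ih =>
    have hd : a.divX.natDegree = n := by rw [natDegree_divX_eq_natDegree_tsub_one, h]; rfl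
    have hd0 : a.divX ≠ 0 := fun h0 => by
      rw [divX_eq_zero_iff] at h0
      rw [h0, natDegree_C] at h
      omega
    have e : ‖ofA F (a.divX * X)‖ = ‖ofA F X‖ ^ (n + 1) := by
      rw [map_mul, norm_mul, ih hd0 hd, pow_succ]
    have hlt : ‖ofA F (C (a.coeff 0))‖ < ‖ofA F (a.divX * X)‖ :=
      (norm_ofA_C_le _).trans_lt (e ▸ one_lt_pow₀ one_lt_norm_ofA_X n.succ_ne_zero)
    rw [← divX_mul_X_add a, map_add,
      IsUltrametricDist.norm_add_eq_max_of_norm_ne_norm hlt.ne', max_eq_left hlt.le, e]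

theorem ofA_ne_zero {a : F[X]} (ha : a ≠ 0) : ofA F a ≠ 0 := by
  rw [← norm_pos_iff, norm_ofA ha]
  exact pow_pos (one_pos.trans one_lt_norm_ofA_X) _

theorem ofA_injective : Function.Injective (ofA F) :=
  (injective_iff_map_eq_zero _).2 fun _ h => by_contra fun h0 => ofA_ne_zero h0 h

instance : Infinite (CInfty F) := Infinite.of_injective _ (ofA_injective (F := F))

variable (F) in
open Classical in
/-- The polynomials of degree less than `N`. -/
def lowDeg : ℕ → Finset F[X]
  | 0 => {0}
  | N + 1 => (lowDeg N ×ˢ (Finset.univ : Finset F)).image fun b => b.1 * X + C b.2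

theorem mem_lowDeg {N : ℕ} {a : F[X]} : a ∈ lowDeg F N ↔ a.degree < N := by
  induction N generalizing a with
  | zero => simp [lowDeg]
  | succ N ih =>
    simp only [lowDeg, Finset.mem_image, Finset.mem_product, Finset.mem_univ, and_true, ih,
      degree_lt_iff_coeff_zero]
    constructor
    · rintro ⟨⟨b, c⟩, hb, rfl⟩ m hm
      obtain ⟨m, rfl⟩ := Nat.exists_eq_succ_of_ne_zero (n := m) (by omega)
      simpa [coeff_C] using hb m (by omega)
    · intro h
      exact ⟨⟨a.divX, a.coeff 0⟩, fun m hm => by simpa using h (m + 1) (by omega),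
        divX_mul_X_add a⟩

theorem zero_mem_lowDeg (N : ℕ) : (0 : F[X]) ∈ lowDeg F N := by
  simp [mem_lowDeg, degree_zero]

/-- Sorting by constant term expresses `e_{N+1}(T y)` through translates of `e_N(y)`. -/
theorem prod_lowDeg_succ {M : Type*} [CommMonoid M] (N : ℕ) (f : F[X] → M) :
    ∏ a ∈ lowDeg F (N + 1), f a = ∏ c : F, ∏ b ∈ lowDeg F N, f (b * X + C c) := by
  classical
  rw [lowDeg, Finset.prod_image, Finset.prod_product_right]
  rintro ⟨b, c⟩ - ⟨b', c'⟩ - h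
  have h0 := congrArg (coeff · 0) h
  have h1 : b = b' := by
    ext m
    simpa [coeff_C] using congrArg (coeff · (m + 1)) h
  simp_all

theorem tendsto_lowDeg : Tendsto (lowDeg F) atTop atTop := by
  refine tendsto_atTop_finset_of_monotone (fun N M h a ha => ?_) fun a => ?_
  · rw [mem_lowDeg] at ha ⊢
    exact ha.trans_le (by exact_mod_cast h)
  · refine ⟨a.natDegree + 1, mem_lowDeg.2 (degree_le_natDegree.trans_lt ?_)⟩
    exact_mod_cast Nat.lt_succ_self _

theorem tendsto_norm_ofA_cofinite : Tendsto (fun a : F[X] => ‖ofA F a‖) cofinite atTop := by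
  rw [tendsto_atTop]
  intro B
  obtain ⟨N, hN⟩ := pow_unbounded_of_one_lt B (one_lt_norm_ofA_X (F := F))
  rw [eventually_cofinite]
  refine (lowDeg F N).finite_toSet.subset fun a ha => ?_
  rcases eq_or_ne a 0 with rfl | h0
  · exact zero_mem_lowDeg N
  rw [Finset.mem_coe, mem_lowDeg, ← natDegree_lt_iff_degree_lt h0]
  by_contra! hle
  refine ha ?_
  rw [norm_ofA h0]
  exact hN.le.trans (pow_le_pow_right₀ one_lt_norm_ofA_X.le hle)

end Drinfeld

/-! ### Frobenius and products over the constants -/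

section Frobenius

variable {F : Type*} [Field F] [Fintype F]

theorem add_pow_card_pow_of_ringHom {R : Type*} [CommRing R] [Nontrivial R] (φ : F →+* R)
    (x y : R) (i : ℕ) : (x + y) ^ Fintype.card F ^ i =
      x ^ Fintype.card F ^ i + y ^ Fintype.card F ^ i := by
  obtain ⟨p, _⟩ := CharP.exists F
  obtain ⟨m, hp, hm⟩ := FiniteField.card F p
  have : CharP R p := charP_of_injective_ringHom φ.injective p
  have : Fact p.Prime := ⟨hp⟩
  rw [hm, ← pow_mul]
  exact add_pow_char_pow ..

theorem sum_pow_card_of_ringHom {R ι : Type*} [CommRing R] [Nontrivial R] (φ : F →+* R)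
    (s : Finset ι) (f : ι → R) :
    (∑ i ∈ s, f i) ^ Fintype.card F = ∑ i ∈ s, f i ^ Fintype.card F := by
  classical
  induction s using Finset.induction_on with
  | empty => simp
  | insert a s ha ih =>
    rw [Finset.sum_insert ha, Finset.sum_insert ha, ← ih]
    simpa using add_pow_card_pow_of_ringHom φ (f a) (∑ i ∈ s, f i) 1

open Classical in
theorem prod_X_sub_C_erase_zero :
    ∏ c ∈ Finset.univ.erase (0 : F), (X - C c) = X ^ (Fintype.card F - 1) - 1 := by
  have hq : 1 < Fintype.card F := Fintype.one_lt_card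
  have hprod : ∏ c : F, (X - C c) = X ^ Fintype.card F - X := by
    have h := prod_multiset_X_sub_C_of_monic_of_roots_card_eq (p := (X ^ Fintype.card F - X : F[X]))
      (monic_X_pow_sub (by rw [degree_X]; exact_mod_cast hq))
      (by rw [FiniteField.roots_X_pow_card_sub_X, FiniteField.X_pow_card_sub_X_natDegree_eq F hq]
          rfl)
    rwa [FiniteField.roots_X_pow_card_sub_X] at h
  refine mul_left_cancel₀ (X_ne_zero (R := F)) ?_
  have h := Finset.mul_prod_erase Finset.univ (fun c : F => X - C c) (Finset.mem_univ 0)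
  rw [hprod, C_0, sub_zero] at h
  rw [h, mul_sub, mul_one, ← pow_succ', Nat.sub_add_cancel hq.le]

open Classical in
theorem prod_one_sub_div_erase_zero {L : Type*} [Field L] (φ : F →+* L) (z : L) :
    ∏ c ∈ Finset.univ.erase (0 : F), (1 - z / φ c) = 1 - z ^ (Fintype.card F - 1) := by
  have hev : ∀ y : L, ∏ c ∈ Finset.univ.erase (0 : F), (y - φ c) =
      y ^ (Fintype.card F - 1) - 1 := fun y => by
    simpa [eval₂_finsetProd] using congrArg (eval₂ φ y) (prod_X_sub_C_erase_zero (F := F))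
  have h0 := hev 0
  rw [zero_pow (Nat.sub_ne_zero_of_lt Fintype.one_lt_card)] at h0
  have : ∀ c ∈ Finset.univ.erase (0 : F), 1 - z / φ c = (z - φ c) / (0 - φ c) := by
    intro c hc
    have : φ c ≠ 0 := (map_ne_zero φ).2 (Finset.ne_of_mem_erase hc)
    field_simp
    ring
  rw [Finset.prod_congr rfl this, Finset.prod_div_distrib, hev, h0]
  ring

end Frobenius

/-! ### Finite lattice exponentials as `q`-polynomials -/

namespace Drinfeld

variable {F : Type*} [Field F] [Fintype F]

open Classical in
/-- The factor of the lattice exponential of `π A` which belongs to `a ∈ A`. -/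
def expFactor (π : CInfty F) (a : F[X]) (x : CInfty F) : CInfty F :=
  if a = 0 then x else 1 - x / (π * ofA F a)

/-- The lattice exponential of the finite lattice `{π a | deg a < N}`. -/
def partialExp (π : CInfty F) (N : ℕ) (x : CInfty F) : CInfty F :=
  ∏ a ∈ lowDeg F N, expFactor π a x

variable {π : CInfty F}

theorem tendsto_div_ofA_cofinite (hπ : π ≠ 0) (x : CInfty F) :
    Tendsto (fun a : F[X] => x / (π * ofA F a)) cofinite (𝓝 0) := by
  rw [tendsto_zero_iff_norm_tendsto_zero]
  simp only [norm_div, norm_mul]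
  exact (tendsto_norm_ofA_cofinite.const_mul_atTop (norm_pos_iff.2 hπ)).const_div_atTop _

/-- Unconditional convergence, reindexed by `A`, lets the exponential be computed along the degree
filtration `lowDeg`. -/
theorem hasProd_expFactor (hπ : π ≠ 0) (x : CInfty F) :
    HasProd (fun a => expFactor π a x) (latticeExp (periodLattice π) x) := by
  classical
  let e : {a : F[X] // a ≠ 0} ≃ {l : CInfty F // l ∈ periodLattice π ∧ l ≠ 0} :=
    Equiv.ofBijective
      (fun a => ⟨π * ofA F a, ⟨a, rfl⟩, mul_ne_zero hπ (ofA_ne_zero a.2)⟩)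
      ⟨fun a b h => Subtype.ext (ofA_injective (mul_left_cancel₀ hπ (Subtype.ext_iff.1 h))), by
        rintro ⟨_, ⟨a, rfl⟩, ha⟩
        exact ⟨⟨a, fun h => ha (by simp [h])⟩, rfl⟩⟩
  have hm : Multipliable fun a : {a : F[X] // a ≠ 0} => 1 - x / (π * ofA F (a : F[X])) := by
    simp only [sub_eq_add_neg]
    refine multipliable_one_add_of_tendsto_cofinite_zero ?_
    simpa using ((tendsto_div_ofA_cofinite hπ x).comp
      Subtype.val_injective.tendsto_cofinite).neg
  have h1 := hm.hasProd
  have h2 : ∏' l : {l : CInfty F // l ∈ periodLattice π ∧ l ≠ 0}, (1 - x / (l : CInfty F)) =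
      ∏' a : {a : F[X] // a ≠ 0}, (1 - x / (π * ofA F (a : F[X]))) :=
    (e.tprod_eq fun l => 1 - x / (l : CInfty F)).symm
  rw [← h2] at h1
  have h3 := (hasProd_subtype_iff_mulIndicator (s := {a : F[X] | a ≠ 0})
    (f := fun a : F[X] => 1 - x / (π * ofA F a))).1 h1
  have h4 := (hasProd_ite_eq (0 : F[X]) x).mul h3
  rw [latticeExp]
  convert h4 using 2 with a
  by_cases ha : a = 0 <;> simp [expFactor, ha]

theorem tendsto_partialExp (hπ : π ≠ 0) (x : CInfty F) :
    Tendsto (fun N => partialExp π N x) atTop (𝓝 (latticeExp (periodLattice π) x)) := by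
  have h := hasProd_expFactor hπ x
  rw [HasProd, SummationFilter.unconditional_filter] at h
  exact h.comp tendsto_lowDeg

theorem one_le_norm_ofA {a : F[X]} (ha : a ≠ 0) : 1 ≤ ‖ofA F a‖ := by
  rw [norm_ofA ha]
  exact one_le_pow₀ one_lt_norm_ofA_X.le

/-- Below the shortest nonzero period every factor except the one for `a = 0` is a 1-unit. This
keeps `e_N(π/T)` away from 0. -/
theorem norm_partialExp {x : CInfty F} (hx : ‖x‖ < ‖π‖) (N : ℕ) : ‖partialExp π N x‖ = ‖x‖ := by
  have hπ : π ≠ 0 := norm_pos_iff.1 ((norm_nonneg x).trans_lt hx)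
  rw [partialExp, norm_prod, Finset.prod_eq_single 0 _ fun h => absurd (zero_mem_lowDeg N) h]
  · simp [expFactor]
  intro a _ ha
  rw [expFactor, if_neg ha, sub_eq_add_neg]
  refine norm_one_add_eq_one ?_
  rw [norm_neg, norm_div, norm_mul, div_lt_one
    (mul_pos (norm_pos_iff.2 hπ) (norm_pos_iff.2 (ofA_ne_zero ha)))]
  exact hx.trans_le (le_mul_of_one_le_right (norm_nonneg _) (one_le_norm_ofA ha))

theorem norm_latticeExp {x : CInfty F} (hx : ‖x‖ < ‖π‖) :
    ‖latticeExp (periodLattice π) x‖ = ‖x‖ := by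
  have hπ : π ≠ 0 := norm_pos_iff.1 ((norm_nonneg x).trans_lt hx)
  have h := (tendsto_partialExp hπ x).norm
  simp only [norm_partialExp hx] at h
  exact (tendsto_nhds_unique h tendsto_const_nhds)

open Classical in
/-- The constant `κ_N` with `e_N(x) = κ_N ∏_{deg a < N} (x - π a)`. -/
def expScale (π : CInfty F) (N : ℕ) : CInfty F :=
  ∏ a ∈ lowDeg F N, if a = 0 then 1 else -(π * ofA F a)⁻¹

theorem expScale_ne_zero (hπ : π ≠ 0) (N : ℕ) : expScale π N ≠ 0 := by
  refine Finset.prod_ne_zero_iff.2 fun a _ => ?_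
  split_ifs with h
  · exact one_ne_zero
  · exact neg_ne_zero.2 (inv_ne_zero (mul_ne_zero hπ (ofA_ne_zero h)))

theorem partialExp_eq_scale_mul (hπ : π ≠ 0) (N : ℕ) (x : CInfty F) :
    partialExp π N x = expScale π N * ∏ a ∈ lowDeg F N, (x - π * ofA F a) := by
  rw [partialExp, expScale, ← Finset.prod_mul_distrib]
  refine Finset.prod_congr rfl fun a _ => ?_
  rw [expFactor]
  split_ifs with h
  · simp [h]
  · have := ofA_ne_zero h
    field_simp
    ring

theorem partialExp_eq_zero_iff (hπ : π ≠ 0) {N : ℕ} {x : CInfty F} :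
    partialExp π N x = 0 ↔ ∃ a ∈ lowDeg F N, x = π * ofA F a := by
  simp [partialExp_eq_scale_mul hπ, expScale_ne_zero hπ, Finset.prod_eq_zero_iff, sub_eq_zero]

variable (F) in
/-- The inclusion of the constants. -/
def ofConst : F →+* CInfty F := (ofA F).comp C

theorem ofConst_pow_card_pow (c : F) (i : ℕ) :
    ofConst F c ^ Fintype.card F ^ i = ofConst F c := by
  rw [← map_pow, FiniteField.pow_card_pow]

/-- The coefficient `c_N` in `e_{N+1}(T x) = T e_N(x) + c_N e_N(x)^q`. -/
def expStep (π : CInfty F) (N : ℕ) : CInfty F :=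
  -ofA F X / partialExp π N (π / ofA F X) ^ (Fintype.card F - 1)

/-- The coefficients of the `q`-polynomial `e_N`. -/
def expCoeff (π : CInfty F) : ℕ → ℕ → CInfty F
  | 0, 0 => 1
  | 0, _ + 1 => 0
  | _ + 1, 0 => 1
  | N + 1, i + 1 =>
    (ofA F X * expCoeff π N (i + 1) + expStep π N * expCoeff π N i ^ Fintype.card F) /
      ofA F X ^ Fintype.card F ^ (i + 1)

theorem expCoeff_zero_right (N : ℕ) : expCoeff π N 0 = 1 := by
  cases N <;> rfl

theorem expCoeff_of_lt {N i : ℕ} (h : N < i) : expCoeff π N i = 0 := by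
  induction N generalizing i with
  | zero => obtain ⟨i, rfl⟩ := Nat.exists_eq_succ_of_ne_zero h.ne'; rfl
  | succ N ih =>
    obtain ⟨i, rfl⟩ := Nat.exists_eq_succ_of_ne_zero (n := i) (by omega)
    simp [expCoeff, ih (i := i + 1) (by omega), ih (i := i) (by omega)]

/-- `e_N` as a `q`-polynomial. -/
def expPoly (π : CInfty F) (N : ℕ) : (CInfty F)[X] :=
  ∑ i ∈ Finset.range (N + 1), C (expCoeff π N i) * X ^ Fintype.card F ^ i

theorem eval_expPoly (N : ℕ) (x : CInfty F) : (expPoly π N).eval x =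
    ∑ i ∈ Finset.range (N + 1), expCoeff π N i * x ^ Fintype.card F ^ i := by
  simp [expPoly, eval_finsetSum]

theorem eval_expPoly_sub_mul (N : ℕ) (x y : CInfty F) (c : F) :
    (expPoly π N).eval (x - ofConst F c * y) =
      (expPoly π N).eval x - ofConst F c * (expPoly π N).eval y := by
  simp only [eval_expPoly, Finset.mul_sum, ← Finset.sum_sub_distrib]
  refine Finset.sum_congr rfl fun i _ => ?_
  have h : (x - ofConst F c * y) ^ Fintype.card F ^ i =
      x ^ Fintype.card F ^ i - ofConst F c * y ^ Fintype.card F ^ i := by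
    rw [sub_eq_add_neg, ← neg_mul, ← map_neg, add_pow_card_pow_of_ringHom (ofConst F), mul_pow,
      ofConst_pow_card_pow, map_neg]
    ring
  rw [h]
  ring

theorem ofA_X_ne_zero : ofA F X ≠ 0 := ofA_ne_zero X_ne_zero

theorem norm_div_ofA_X_lt (hπ : π ≠ 0) : ‖π / ofA F X‖ < ‖π‖ := by
  rw [norm_div]
  exact div_lt_self (norm_pos_iff.2 hπ) one_lt_norm_ofA_X

theorem partialExp_div_ofA_X_ne_zero (hπ : π ≠ 0) (N : ℕ) :
    partialExp π N (π / ofA F X) ≠ 0 := by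
  rw [← norm_pos_iff, norm_partialExp (norm_div_ofA_X_lt hπ), norm_pos_iff]
  exact div_ne_zero hπ ofA_X_ne_zero

theorem expPoly_succ_eval (N : ℕ) (y : CInfty F) :
    (expPoly π (N + 1)).eval (ofA F X * y) =
      ofA F X * (expPoly π N).eval y + expStep π N * (expPoly π N).eval y ^ Fintype.card F := by
  have hθ := ofA_X_ne_zero (F := F)
  -- The top term, of index `N + 1`, is zero; it is included so that all sums have the same range.
  have h1 : (expPoly π N).eval y =
      y + ∑ i ∈ Finset.range (N + 1), expCoeff π N (i + 1) * y ^ Fintype.card F ^ (i + 1) := by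
    rw [eval_expPoly, Finset.sum_range_succ', Finset.sum_range_succ,
      expCoeff_of_lt (Nat.lt_succ_self N), expCoeff_zero_right]
    simp [add_comm]
  have h2 : (expPoly π N).eval y ^ Fintype.card F = ∑ i ∈ Finset.range (N + 1),
      expCoeff π N i ^ Fintype.card F * y ^ Fintype.card F ^ (i + 1) := by
    rw [eval_expPoly, sum_pow_card_of_ringHom (ofConst F)]
    exact Finset.sum_congr rfl fun i _ => by rw [mul_pow, ← pow_mul, ← pow_succ]
  rw [h2, h1, eval_expPoly, Finset.sum_range_succ', mul_add, add_assoc, Finset.mul_sum,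
    Finset.mul_sum, ← Finset.sum_add_distrib, add_comm]
  congr 1
  · simp [expCoeff_zero_right]
  refine Finset.sum_congr rfl fun i _ => ?_
  rw [expCoeff, mul_pow]
  field_simp

/-- The finite lattice exponentials are `q`-polynomials. -/
theorem partialExp_eq_eval (hπ : π ≠ 0) (N : ℕ) (x : CInfty F) :
    partialExp π N x = (expPoly π N).eval x := by
  classical
  induction N generalizing x with
  | zero => simp [partialExp, lowDeg, expFactor, eval_expPoly, expCoeff]
  | succ N ih =>
    have hθ := ofA_X_ne_zero (F := F)
    obtain ⟨y, rfl⟩ : ∃ y, x = ofA F X * y := ⟨x / ofA F X, by field_simp⟩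
    set w := partialExp π N (π / ofA F X) with hw
    have hw0 : w ≠ 0 := partialExp_div_ofA_X_ne_zero hπ N
    rw [expPoly_succ_eval, ← ih y]
    set Y := partialExp π N y with hY
    -- Constant term 0: the factor `T` cancels in `T y / (π b T)` for `b ≠ 0` and survives only for
    -- `b = 0`.
    have hzero : ∏ b ∈ lowDeg F N, expFactor π (b * X + C 0) (ofA F X * y) = ofA F X * Y := by
      rw [hY, partialExp, ← Finset.mul_prod_erase _ _ (zero_mem_lowDeg N),
        ← Finset.mul_prod_erase _ _ (zero_mem_lowDeg N), ← mul_assoc]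
      congr 1
      · simp [expFactor]
      refine Finset.prod_congr rfl fun b hb => ?_
      have hb0 := Finset.ne_of_mem_erase hb
      have := ofA_ne_zero hb0
      rw [C_0, add_zero, expFactor, expFactor, if_neg hb0, if_neg (mul_ne_zero hb0 X_ne_zero),
        map_mul]
      field_simp
    -- Constant term `c ≠ 0`: the product is `e_N(y - cπ/T) / e_N(-cπ/T)`, which by `F`-linearity of
    -- `e_N` is `(Y - c w) / (-c w)`. The product over `c` is then `1 - (Y/w)^{q-1}`.
    have hne : ∀ c ∈ Finset.univ.erase (0 : F),
        ∏ b ∈ lowDeg F N, expFactor π (b * X + C c) (ofA F X * y) =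
          1 - Y / w / ofConst F c := by
      intro c hc
      have hc0 : c ≠ 0 := Finset.ne_of_mem_erase hc
      have hφ : ofConst F c ≠ 0 := (_root_.map_ne_zero _).2 hc0
      have hbc : ∀ b : F[X], b * X + C c ≠ 0 := fun b h => hc0 <| by
        simpa using congrArg (coeff · 0) h
      have hterm : ∀ b ∈ lowDeg F N, expFactor π (b * X + C c) (ofA F X * y) =
          ((y - ofConst F c * (π / ofA F X)) - π * ofA F b) /
            ((0 - ofConst F c * (π / ofA F X)) - π * ofA F b) := by
        intro b _
        have h1 := ofA_ne_zero (hbc b)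
        have h2 : ofA F (b * X + C c) = ofA F b * ofA F X + ofConst F c := by
          simp [ofConst]
        rw [h2] at h1
        have h3 : (0 - ofConst F c * (π / ofA F X)) - π * ofA F b =
            -(π / ofA F X * (ofA F b * ofA F X + ofConst F c)) := by
          field_simp
          ring
        rw [expFactor, if_neg (hbc b), h2, h3, sub_eq_iff_eq_add,
          div_add_div _ _ (by simp [hπ, hθ, h1])
          (mul_ne_zero hπ h1), eq_div_iff (by simp [hπ, hθ, h1])]
        field_simp
        ring
      have hκ := expScale_ne_zero hπ N
      rw [Finset.prod_congr rfl hterm, Finset.prod_div_distrib,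
        ← mul_div_mul_left _ _ hκ, ← partialExp_eq_scale_mul hπ, ← partialExp_eq_scale_mul hπ,
        ih, ih, eval_expPoly_sub_mul, eval_expPoly_sub_mul, ← ih, ← ih, ← ih, ← hw, ← hY]
      have h0 : partialExp π N 0 = 0 :=
        (partialExp_eq_zero_iff hπ).2 ⟨0, zero_mem_lowDeg N, by simp⟩
      rw [h0]
      field_simp
      ring
    rw [partialExp, prod_lowDeg_succ, ← Finset.mul_prod_erase _ _ (Finset.mem_univ (0 : F)),
      hzero, Finset.prod_congr rfl hne, prod_one_sub_div_erase_zero, expStep, ← hw]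
    obtain ⟨m, hm⟩ := Nat.exists_eq_succ_of_ne_zero (n := Fintype.card F) Fintype.card_ne_zero
    have hwm : w ^ m ≠ 0 := pow_ne_zero _ hw0
    rw [hm, Nat.succ_sub_one, div_pow, pow_succ]
    generalize w ^ m = v at *
    field_simp
    ring

theorem partialExp_sub (hπ : π ≠ 0) (N : ℕ) (x y : CInfty F) :
    partialExp π N (x - y) = partialExp π N x - partialExp π N y := by
  simpa [partialExp_eq_eval hπ] using eval_expPoly_sub_mul N x y 1

end Drinfeld

/-! ### The generating function formula for Goss polynomials -/

section GossFormula

variable {R : Type*} [CommRing R]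

/-- The coefficient of `uⁿ⁻¹` in `X / (1 - X f(u))`, for a power series `f` without constant
term. -/
def gossFormula (f : PowerSeries R) (n : ℕ) : R[X] :=
  ∑ k ∈ Finset.range n, C (PowerSeries.coeff (n - 1) (f ^ k)) * X ^ (k + 1)

theorem eval_gossFormula (f : PowerSeries R) (n : ℕ) (x : R) : (gossFormula f n).eval x =
    ∑ k ∈ Finset.range n, PowerSeries.coeff (n - 1) (f ^ k) * x ^ (k + 1) := by
  simp [gossFormula, eval_finsetSum]

theorem coeff_gossFormula_zero (f : PowerSeries R) (n : ℕ) : (gossFormula f n).coeff 0 = 0 := by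
  simp [gossFormula, finsetSum_coeff]

/-- Only coefficients of `f` of index below `n` enter, which is why `n ≤ q^d` will suffice for
integrality. -/
theorem coeff_gossFormula_mem {S : Subring R} {f : PowerSeries R} {n : ℕ}
    (hf : ∀ m < n, PowerSeries.coeff m f ∈ S) (j : ℕ) : (gossFormula f n).coeff j ∈ S := by
  have hpow : ∀ k, ∀ m < n, PowerSeries.coeff m (f ^ k) ∈ S := by
    intro k
    induction k with
    | zero =>
      intro m _
      rw [pow_zero, PowerSeries.coeff_one]
      split_ifs
      exacts [S.one_mem, S.zero_mem]
    | succ k ih =>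
      intro m hm
      rw [pow_succ, PowerSeries.coeff_mul]
      refine S.sum_mem fun i hi => ?_
      have := Finset.HasAntidiagonal.mem_antidiagonal.1 hi
      exact S.mul_mem (ih _ (by omega)) (hf _ (by omega))
  rw [gossFormula, finsetSum_coeff]
  refine S.sum_mem fun k hk => ?_
  have := Finset.mem_range.1 hk
  rw [coeff_C_mul, coeff_X_pow]
  refine S.mul_mem (hpow k _ (by omega)) ?_
  split_ifs
  exacts [S.one_mem, S.zero_mem]

/-- Expand `W = 1 / (e - f)` as a geometric series in `f / e`; since `X ∣ f`, powers beyond the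
`n`-th do not reach the coefficient of index `n`. -/
theorem coeff_eq_eval_gossFormula {K : Type*} [Field K] {f W : PowerSeries K} {e : K}
    (hf : PowerSeries.X ∣ f) (he : e ≠ 0) (h : W * (PowerSeries.C e - f) = 1) (n : ℕ) :
    PowerSeries.coeff n W = (gossFormula f (n + 1)).eval e⁻¹ := by
  have hg : (PowerSeries.C e - f) *
      ∑ k ∈ Finset.range (n + 1), f ^ k * PowerSeries.C e⁻¹ ^ (k + 1) =
        1 - (f * PowerSeries.C e⁻¹) ^ (n + 1) := by
    have hC : PowerSeries.C e * PowerSeries.C e⁻¹ = 1 := by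
      rw [← map_mul, mul_inv_cancel₀ he, map_one]
    have hs : ∑ k ∈ Finset.range (n + 1), f ^ k * PowerSeries.C e⁻¹ ^ (k + 1) =
        PowerSeries.C e⁻¹ * ∑ k ∈ Finset.range (n + 1), (f * PowerSeries.C e⁻¹) ^ k := by
      rw [Finset.mul_sum]
      exact Finset.sum_congr rfl fun k _ => by ring
    rw [hs, ← mul_assoc, sub_mul, hC, mul_neg_geom_sum]
  have hW := congrArg (W * ·) hg
  simp only [← mul_assoc] at hW
  rw [h, one_mul, mul_sub, mul_one] at hW
  have h0 : PowerSeries.coeff n (W * (f * PowerSeries.C e⁻¹) ^ (n + 1)) = 0 := by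
    have hd : PowerSeries.X ^ (n + 1) ∣ W * (f * PowerSeries.C e⁻¹) ^ (n + 1) :=
      (pow_dvd_pow_of_dvd (hf.mul_right _) _).mul_left _
    exact PowerSeries.X_pow_dvd_iff.1 hd n (Nat.lt_succ_self n)
  have := congrArg (PowerSeries.coeff n) hW
  rw [map_sub, h0, sub_zero] at this
  rw [← this, eval_gossFormula, map_sum]
  refine Finset.sum_congr rfl fun k _ => ?_
  rw [← map_pow, PowerSeries.coeff_mul_C, Nat.add_sub_cancel]

theorem tendsto_eval_gossFormula [TopologicalSpace R] [IsTopologicalRing R]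
    {ι : Type*} {l : Filter ι} {f : ι → PowerSeries R} {g : PowerSeries R} {x : ι → R} {y : R}
    (hf : ∀ m, Tendsto (fun i => PowerSeries.coeff m (f i)) l (𝓝 (PowerSeries.coeff m g)))
    (hx : Tendsto x l (𝓝 y)) (n : ℕ) :
    Tendsto (fun i => (gossFormula (f i) n).eval (x i)) l (𝓝 ((gossFormula g n).eval y)) := by
  have hpow : ∀ k m, Tendsto (fun i => PowerSeries.coeff m (f i ^ k)) l
      (𝓝 (PowerSeries.coeff m (g ^ k))) := by
    intro k
    induction k with
    | zero => intro m; simpa using tendsto_const_nhds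
    | succ k ih =>
      intro m
      simp only [pow_succ, PowerSeries.coeff_mul]
      exact tendsto_finsetSum _ fun i _ => (ih _).mul (hf _)
  simp only [eval_gossFormula]
  exact tendsto_finsetSum _ fun k _ => (hpow k _).mul (hx.pow _)

end GossFormula

/-! ### The Goss identity for finite lattices -/

namespace Drinfeld

variable {F : Type*} [Field F] [Fintype F] {π : CInfty F}

theorem derivative_expPoly (N : ℕ) : derivative (expPoly π N) = 1 := by
  have hq : (Fintype.card F : CInfty F) = 0 := by
    have h := congrArg (ofConst F) (FiniteField.cast_card_eq_zero F)
    rwa [map_natCast, map_zero] at h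
  rw [expPoly, derivative_sum, Finset.sum_range_succ', Finset.sum_eq_zero]
  · simp [expCoeff_zero_right]
  · intro i _
    simp [derivative_X_pow, hq]

theorem C_sub_expPoly (hπ : π ≠ 0) (N : ℕ) (z : CInfty F) :
    C (partialExp π N z) - expPoly π N =
      C (expScale π N) * ∏ a ∈ lowDeg F N, (C (z - π * ofA F a) - X) := by
  refine Polynomial.funext fun u => ?_
  rw [eval_sub, eval_C, ← partialExp_eq_eval hπ, ← partialExp_sub hπ, partialExp_eq_scale_mul hπ,
    eval_mul, eval_C, eval_prod]
  congr 1
  exact Finset.prod_congr rfl fun a _ => by simp; ring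

theorem powerSeries_inv_mul {K : Type*} [Field K] {y : K} (hy : y ≠ 0) :
    (PowerSeries.mk fun n => (y ^ (n + 1))⁻¹) * (PowerSeries.C y - PowerSeries.X) = 1 := by
  ext n
  rw [mul_sub, map_sub, PowerSeries.coeff_mul_C]
  rcases n with _ | n
  · simp [hy]
  · rw [PowerSeries.coeff_succ_mul_X, PowerSeries.coeff_one, if_neg n.succ_ne_zero]
    simp only [PowerSeries.coeff_mk]
    field_simp
    ring

/-- By additivity `e_N(z) - e_N(u) = κ_N ∏ (z - π a - u)`, whose `u`-derivative is `-1`. The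
logarithmic derivative gives `∑ 1 / (z - π a - u) = 1 / (e_N(z) - e_N(u))`, expanded here in powers
of `u`. -/
theorem sum_inv_pow_series_mul (hπ : π ≠ 0) {N : ℕ} {z : CInfty F}
    (hz : ∀ a ∈ lowDeg F N, z ≠ π * ofA F a) :
    (PowerSeries.mk fun n => ∑ a ∈ lowDeg F N, ((z - π * ofA F a) ^ (n + 1))⁻¹) *
      (PowerSeries.C (partialExp π N z) - (expPoly π N : PowerSeries (CInfty F))) = 1 := by
  classical
  have hQ := C_sub_expPoly hπ N z
  have hD := congrArg derivative hQ
  rw [derivative_sub, derivative_expPoly, derivative_C, zero_sub, derivative_C_mul,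
    derivative_prod_finset] at hD
  have hD' : ∑ a ∈ lowDeg F N, C (expScale π N) *
      ∏ b ∈ (lowDeg F N).erase a, (C (z - π * ofA F b) - X) = 1 := by
    rw [← Finset.mul_sum, ← neg_inj, hD]
    simp only [derivative_sub, derivative_C, derivative_X, zero_sub, mul_neg, mul_one,
      Finset.sum_neg_distrib]
  have hW : (PowerSeries.mk fun n => ∑ a ∈ lowDeg F N, ((z - π * ofA F a) ^ (n + 1))⁻¹) =
      ∑ a ∈ lowDeg F N, PowerSeries.mk fun n => ((z - π * ofA F a) ^ (n + 1))⁻¹ := by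
    ext n
    simp
  have hQ' : PowerSeries.C (partialExp π N z) - (expPoly π N : PowerSeries (CInfty F)) =
      ((C (partialExp π N z) - expPoly π N : (CInfty F)[X]) : PowerSeries (CInfty F)) := by
    rw [Polynomial.coe_sub, Polynomial.coe_C]
  rw [hW, hQ', hQ, Finset.sum_mul, ← Polynomial.coe_one, ← hD', ← coeToPowerSeries.ringHom_apply,
    ← coeToPowerSeries.ringHom_apply, map_sum]
  refine Finset.sum_congr rfl fun a ha => ?_
  rw [← Finset.mul_prod_erase _ _ ha, map_mul, map_mul, map_mul, map_sub,
    mul_left_comm (coeToPowerSeries.ringHom _), ← mul_assoc]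
  simp only [coeToPowerSeries.ringHom_apply, Polynomial.coe_C, Polynomial.coe_X]
  rw [powerSeries_inv_mul (sub_ne_zero.2 (hz a ha)), one_mul]

/-- The range does not depend on `N`, so limits can be taken termwise; this is possible because `q^i
> i` and `expCoeff π N i = 0` for `i > N`. -/
theorem coeff_expPoly (N m : ℕ) : (expPoly π N).coeff m =
    ∑ i ∈ Finset.range (m + 1), if m = Fintype.card F ^ i then expCoeff π N i else 0 := by
  have hc : (expPoly π N).coeff m = ∑ i ∈ Finset.range (N + 1),
      if m = Fintype.card F ^ i then expCoeff π N i else 0 := by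
    simp [expPoly, finsetSum_coeff, coeff_X_pow]
  rw [hc]
  refine Finset.sum_congr_of_eq_on_inter (fun i _ hi => if_neg ?_) (fun i _ hi => ?_)
    fun _ _ _ => rfl
  · rintro rfl
    have := Nat.lt_pow_self (n := i) (Fintype.one_lt_card (α := F))
    simp only [Finset.mem_range, not_lt] at hi
    omega
  · rw [expCoeff_of_lt (by simpa [Nat.lt_succ_iff] using hi), ite_self]

theorem X_dvd_expPoly (N : ℕ) : PowerSeries.X ∣ (expPoly π N : PowerSeries (CInfty F)) := by
  rw [PowerSeries.X_dvd_iff, ← PowerSeries.coeff_zero_eq_constantCoeff_apply,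
    Polynomial.coeff_coe, coeff_expPoly]
  refine Finset.sum_eq_zero fun i _ => if_neg ?_
  exact (pow_pos Fintype.card_pos i).ne

/-- The Goss polynomial identity for finite lattices. -/
theorem sum_inv_pow_eq_eval (hπ : π ≠ 0) {N : ℕ} {z : CInfty F}
    (hz : ∀ a ∈ lowDeg F N, z ≠ π * ofA F a) {n : ℕ} (hn : 0 < n) :
    ∑ a ∈ lowDeg F N, ((z - π * ofA F a) ^ n)⁻¹ =
      (gossFormula (expPoly π N : PowerSeries (CInfty F)) n).eval (partialExp π N z)⁻¹ := by
  obtain ⟨n, rfl⟩ := Nat.exists_eq_succ_of_ne_zero hn.ne'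
  have he : partialExp π N z ≠ 0 := fun h =>
    let ⟨a, ha, e⟩ := (partialExp_eq_zero_iff hπ).1 h
    hz a ha e
  have h := coeff_eq_eval_gossFormula (X_dvd_expPoly N) he (sum_inv_pow_series_mul hπ hz) n
  rwa [PowerSeries.coeff_mk] at h

end Drinfeld

/-! ### Passage to the limit: the Carlitz exponential and its Goss polynomials -/

namespace Drinfeld

variable {F : Type*} [Field F] [Fintype F] {π : CInfty F}

theorem latticeExp_period (hπ : π ≠ 0) : latticeExp (periodLattice π) π = 0 := by
  refine tendsto_nhds_unique (tendsto_partialExp hπ π) (tendsto_const_nhds.congr' ?_)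
  filter_upwards [eventually_ge_atTop 1] with N hN
  refine ((partialExp_eq_zero_iff hπ).2 ⟨1, mem_lowDeg.2 ?_, by simp⟩).symm
  rw [degree_one]
  exact_mod_cast hN

/-- At `z = π/T` the functional equation for `a = T` reads `0 = e(π) = T e(z) + e(z)^q`, and `e(z) ≠
0`. This normalises the limit of `expStep`. -/
theorem IsCarlitzPeriod.latticeExp_div_pow (hπ : IsCarlitzPeriod π) :
    latticeExp (periodLattice π) (π / ofA F X) ^ (Fintype.card F - 1) = -ofA F X := by
  have h0 : latticeExp (periodLattice π) (π / ofA F X) ≠ 0 := by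
    rw [← norm_pos_iff, norm_latticeExp (norm_div_ofA_X_lt hπ.1), norm_pos_iff]
    exact div_ne_zero hπ.1 ofA_X_ne_zero
  have h := hπ.2 X (π / ofA F X)
  have hc : carlitz (X : F[X]) = C X * X + X ^ Fintype.card F := by
    simp [carlitz, carlitzTPow]
  rw [mul_div_cancel₀ _ ofA_X_ne_zero, latticeExp_period hπ.1, carlitzC, hc] at h
  simp only [Polynomial.map_add, Polynomial.map_mul, Polynomial.map_pow, map_C, map_X, eval_add,
    eval_mul, eval_pow, eval_C, eval_X] at h
  refine mul_right_cancel₀ h0 ?_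
  rw [← pow_succ, Nat.sub_add_cancel Fintype.card_pos]
  linear_combination -h

theorem tendsto_expStep (hπ : IsCarlitzPeriod π) : Tendsto (expStep π) atTop (𝓝 1) := by
  have h := ((tendsto_partialExp hπ.1 (π / ofA F X)).pow (Fintype.card F - 1))
  rw [hπ.latticeExp_div_pow] at h
  have hθ : -ofA F X ≠ 0 := neg_ne_zero.2 ofA_X_ne_zero
  have := (tendsto_const_nhds (x := -ofA F X)).div h hθ
  rwa [div_self hθ] at this

variable (F) in
/-- The coefficients `1 / D_i` of the Carlitz exponential. -/
def carlitzExpCoeff : ℕ → CInfty F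
  | 0 => 1
  | i + 1 => carlitzExpCoeff i ^ Fintype.card F / ofA F (X ^ Fintype.card F ^ (i + 1) - X)

theorem one_lt_card_pow_succ (i : ℕ) : 1 < Fintype.card F ^ (i + 1) :=
  Nat.one_lt_pow i.succ_ne_zero Fintype.one_lt_card

theorem tendsto_expCoeff (hπ : IsCarlitzPeriod π) (i : ℕ) :
    Tendsto (fun N => expCoeff π N i) atTop (𝓝 (carlitzExpCoeff F i)) := by
  induction i with
  | zero => simp [expCoeff_zero_right, carlitzExpCoeff]
  | succ i ih =>
    have hθ := ofA_X_ne_zero (F := F)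
    set Q := Fintype.card F ^ (i + 1) with hQ
    have hQ1 : 1 < Q := one_lt_card_pow_succ i
    have hb := ofA_ne_zero (FiniteField.X_pow_card_sub_X_ne_zero F hQ1)
    -- For fixed `i` the recursion in `N` contracts by `T^{1-Q}`; in the limit its fixed point
    -- solves `(T^Q - T) x = D_i^{-q}`, so `x = 1/D_{i+1}`.
    refine tendsto_of_contracting_recursion (r := ofA F X / ofA F X ^ Q)
      (s := fun N => expStep π N * expCoeff π N i ^ Fintype.card F / ofA F X ^ Q) ?_ ?_ fun N => ?_
    · rw [norm_div, norm_pow, div_lt_one (pow_pos (one_pos.trans one_lt_norm_ofA_X) _)]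
      exact lt_self_pow₀ one_lt_norm_ofA_X hQ1
    · have h := ((tendsto_expStep hπ).mul (ih.pow (Fintype.card F))).div_const (ofA F X ^ Q)
      have e : (1 - ofA F X / ofA F X ^ Q) * carlitzExpCoeff F (i + 1) =
          1 * carlitzExpCoeff F i ^ Fintype.card F / ofA F X ^ Q := by
        rw [carlitzExpCoeff, ← hQ]
        rw [map_sub, map_pow] at hb ⊢
        have hθQ := pow_ne_zero Q hθ
        field_simp
      rwa [e]
    · simp only [expCoeff, ← hQ]
      ring

variable (F) in
/-- The power series `∑ u^{q^i} / D_i` of the Carlitz exponential. -/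
def carlitzExpSeries : PowerSeries (CInfty F) :=
  PowerSeries.mk fun m =>
    ∑ i ∈ Finset.range (m + 1), if m = Fintype.card F ^ i then carlitzExpCoeff F i else 0

theorem tendsto_coeff_expPoly (hπ : IsCarlitzPeriod π) (m : ℕ) :
    Tendsto (fun N => PowerSeries.coeff m (expPoly π N : PowerSeries (CInfty F))) atTop
      (𝓝 (PowerSeries.coeff m (carlitzExpSeries F))) := by
  simp only [Polynomial.coeff_coe, coeff_expPoly, carlitzExpSeries, PowerSeries.coeff_mk]
  refine tendsto_finsetSum _ fun i _ => ?_
  split_ifs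
  exacts [tendsto_expCoeff hπ i, tendsto_const_nhds]

theorem summable_inv_pow (hπ : π ≠ 0) (z : CInfty F) {n : ℕ} (hn : 0 < n) :
    Summable fun a : F[X] => ((z - π * ofA F a) ^ n)⁻¹ := by
  refine NonarchimedeanAddGroup.summable_of_tendsto_cofinite_zero ?_
  rw [tendsto_zero_iff_norm_tendsto_zero]
  simp only [norm_inv, norm_pow]
  refine tendsto_inv_atTop_zero.comp ((tendsto_pow_atTop hn.ne').comp ?_)
  refine tendsto_atTop_mono (fun a => (?_ : ‖π‖ * ‖ofA F a‖ + -‖z‖ ≤ _))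
    (tendsto_atTop_add_const_right _ _
      (tendsto_norm_ofA_cofinite.const_mul_atTop (norm_pos_iff.2 hπ)))
  rw [← norm_mul, norm_sub_rev, ← sub_eq_add_neg]
  exact norm_sub_norm_le _ _

theorem tendsto_sum_lowDeg {f : F[X] → CInfty F} {s : CInfty F} (h : HasSum f s) :
    Tendsto (fun N => ∑ a ∈ lowDeg F N, f a) atTop (𝓝 s) := by
  rw [HasSum, SummationFilter.unconditional_filter] at h
  exact h.comp tendsto_lowDeg

/-- The case `n = 1` of the finite identity, `e_N(z) ∑ 1/(z - π a) = 1`, persists in the limit. -/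
theorem latticeExp_ne_zero (hπ : π ≠ 0) {z : CInfty F} (hz : z ∉ periodLattice π) :
    latticeExp (periodLattice π) z ≠ 0 := by
  have hz' : ∀ a : F[X], z ≠ π * ofA F a := fun a h => hz ⟨a, h.symm⟩
  have h1 := (tendsto_sum_lowDeg (summable_inv_pow hπ z one_pos).hasSum).mul
    (tendsto_partialExp hπ z)
  have h2 : ∀ N, (∑ a ∈ lowDeg F N, ((z - π * ofA F a) ^ 1)⁻¹) * partialExp π N z = 1 := by
    intro N
    have he : partialExp π N z ≠ 0 := fun h =>
      let ⟨a, _, e⟩ := (partialExp_eq_zero_iff hπ).1 h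
      hz' a e
    rw [sum_inv_pow_eq_eval hπ (fun a _ => hz' a) one_pos, eval_gossFormula]
    simp [he]
  simp only [h2] at h1
  exact right_ne_zero_of_mul_eq_one (tendsto_nhds_unique h1 tendsto_const_nhds)

theorem isGossPolynomial_gossFormula (hπ : IsCarlitzPeriod π) {n : ℕ} (hn : 0 < n) :
    IsGossPolynomial (periodLattice π) n (gossFormula (carlitzExpSeries F) n) := by
  intro z hz
  have hz' : ∀ a : F[X], z ≠ π * ofA F a := fun a h => hz ⟨a, h.symm⟩
  have hs := (summable_inv_pow hπ.1 z hn).hasSum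
  have h1 := tendsto_sum_lowDeg hs
  simp only [fun N => sum_inv_pow_eq_eval hπ.1 (N := N) (fun a _ => hz' a) hn] at h1
  have h2 := tendsto_eval_gossFormula (tendsto_coeff_expPoly hπ)
    ((tendsto_partialExp hπ.1 z).inv₀ (latticeExp_ne_zero hπ.1 hz)) n
  rw [tendsto_nhds_unique h1 h2] at hs
  have hinj : Function.Injective fun a : F[X] => π * ofA F a :=
    fun a b h => ofA_injective (mul_left_cancel₀ hπ.1 h)
  exact (Equiv.ofInjective _ hinj).hasSum_iff
    (f := fun l : periodLattice π => ((z - (l : CInfty F)) ^ n)⁻¹) |>.1 hs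

/-- Both polynomials agree at `1 / e(π / T^{j+1})` for all `j`; these points are distinct because
`e` preserves norms there. -/
theorem IsGossPolynomial.unique (hπ : π ≠ 0) {n : ℕ} {G H : (CInfty F)[X]}
    (hG : IsGossPolynomial (periodLattice π) n G) (hH : IsGossPolynomial (periodLattice π) n H) :
    G = H := by
  refine eq_of_infinite_eval_eq _ _ ?_
  have hlt : ∀ j : ℕ, ‖π / ofA F X ^ (j + 1)‖ < ‖π‖ := fun j => by
    rw [norm_div, norm_pow]
    exact div_lt_self (norm_pos_iff.2 hπ) (one_lt_pow₀ one_lt_norm_ofA_X j.succ_ne_zero)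
  have hnot : ∀ j : ℕ, π / ofA F X ^ (j + 1) ∉ periodLattice π := by
    rintro j ⟨a, ha⟩
    have h0 : π / ofA F X ^ (j + 1) ≠ 0 := div_ne_zero hπ (pow_ne_zero _ ofA_X_ne_zero)
    have ha0 : a ≠ 0 := by
      rintro rfl
      simp only [map_zero, mul_zero] at ha
      exact h0 ha.symm
    have := hlt j
    rw [← ha, norm_mul] at this
    exact this.not_ge (le_mul_of_one_le_right (norm_nonneg _) (one_le_norm_ofA ha0))
  refine Set.infinite_of_injective_forall_mem
    (f := fun j : ℕ => (latticeExp (periodLattice π) (π / ofA F X ^ (j + 1)))⁻¹) ?_ fun j =>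
    (hG _ (hnot j)).unique (hH _ (hnot j))
  intro i j hij
  have h := congrArg norm (inv_injective hij)
  rw [norm_latticeExp (hlt i), norm_latticeExp (hlt j), norm_div, norm_div, norm_pow, norm_pow,
    div_eq_mul_inv, div_eq_mul_inv, mul_right_inj' (norm_ne_zero_iff.2 hπ), inv_inj] at h
  have := pow_right_injective₀ (one_pos.trans one_lt_norm_ofA_X) one_lt_norm_ofA_X.ne' h
  omega

/-- The Goss polynomials of the Carlitz lattice are given by `u X / (1 - X e_C(u)) = ∑ Gₙ uⁿ`. -/
theorem goss_eq_gossFormula (hπ : IsCarlitzPeriod π) {n : ℕ} (hn : 0 < n) :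
    goss π n = gossFormula (carlitzExpSeries F) n := by
  have h : ∃ G, IsGossPolynomial (periodLattice π) n G := ⟨_, isGossPolynomial_gossFormula hπ hn⟩
  rw [goss, gossPolynomial, dif_pos h]
  exact h.choose_spec.unique hπ.1 (isGossPolynomial_gossFormula hπ hn)

end Drinfeld

/-! ### Localization at `𝔭`, integrality and power congruences -/

namespace Drinfeld

variable {F : Type*} [Field F] [Fintype F]

theorem ofA_ne_zero_of_notMem {I : Ideal F[X]} {s : F[X]} (hs : s ∉ I) : ofA F s ≠ 0 :=
  ofA_ne_zero fun h => hs (h ▸ I.zero_mem)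

theorem ofA_mem_localPow {I : Ideal F[X]} [hI : I.IsPrime] {N : ℕ} {x : F[X]} (hx : x ∈ I ^ N) :
    ofA F x ∈ localPow I N :=
  ⟨x, hx, 1, fun h => hI.ne_top ((Ideal.eq_top_iff_one _).2 h), by simp⟩

theorem add_mem_localPow {I : Ideal F[X]} [hI : I.IsPrime] {N : ℕ} {x y : CInfty F}
    (hx : x ∈ localPow I N) (hy : y ∈ localPow I N) : x + y ∈ localPow I N := by
  obtain ⟨a, ha, s, hs, rfl⟩ := hx
  obtain ⟨b, hb, t, ht, rfl⟩ := hy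
  refine ⟨a * t + s * b, add_mem (Ideal.mul_mem_right _ _ ha) (Ideal.mul_mem_left _ _ hb), s * t,
    hI.mul_notMem hs ht, ?_⟩
  rw [div_add_div _ _ (ofA_ne_zero_of_notMem hs) (ofA_ne_zero_of_notMem ht)]
  simp

theorem mul_mem_localPow {I : Ideal F[X]} [hI : I.IsPrime] {M N : ℕ} {x y : CInfty F}
    (hx : x ∈ localPow I M) (hy : y ∈ localPow I N) : x * y ∈ localPow I (M + N) := by
  obtain ⟨a, ha, s, hs, rfl⟩ := hx
  obtain ⟨b, hb, t, ht, rfl⟩ := hy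
  refine ⟨a * b, ?_, s * t, hI.mul_notMem hs ht, ?_⟩
  · rw [pow_add]
    exact Ideal.mul_mem_mul ha hb
  · rw [div_mul_div_comm]
    simp

theorem ofA_mem_localPow_zero (I : Ideal F[X]) [I.IsPrime] (x : F[X]) :
    ofA F x ∈ localPow I 0 :=
  ofA_mem_localPow (by simp)

/-- The localization `A_𝔭`, as a subring of `C`. -/
def localRing (I : Ideal F[X]) [I.IsPrime] : Subring (CInfty F) where
  carrier := localPow I 0
  mul_mem' hx hy := mul_mem_localPow hx hy
  one_mem' := by simpa using ofA_mem_localPow_zero I 1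
  add_mem' hx hy := add_mem_localPow hx hy
  zero_mem' := by simpa using ofA_mem_localPow_zero I 0
  neg_mem' hx := by simpa using mul_mem_localPow (ofA_mem_localPow_zero I (-1)) hx

theorem inv_ofA_mem_localRing {I : Ideal F[X]} [I.IsPrime] {s : F[X]} (hs : s ∉ I) :
    (ofA F s)⁻¹ ∈ localRing I :=
  ⟨1, by simp, s, hs, by simp⟩

section Integrality

variable {P : F[X]}

/-- An irreducible `P` divides `T^{q^j} - T` only if `deg P ∣ j`, which fails for `0 < j < deg P`.
-/
theorem carlitzExpCoeff_mem_localRing (hP : Irreducible P) [(Ideal.span {P}).IsPrime] {i : ℕ}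
    (hi : i < P.natDegree) : carlitzExpCoeff F i ∈ localRing (Ideal.span {P}) := by
  induction i with
  | zero => exact one_mem _
  | succ i ih =>
    rw [carlitzExpCoeff, div_eq_mul_inv]
    refine mul_mem (pow_mem (ih (by omega)) _) (inv_ofA_mem_localRing fun h => ?_)
    rw [Ideal.mem_span_singleton, ← Nat.card_eq_fintype_card] at h
    exact Nat.not_dvd_of_pos_of_lt i.succ_pos hi (hP.natDegree_dvd_of_dvd_X_pow_card_pow_sub_X h)

theorem coeff_goss_mem_localRing {π : CInfty F} (hπ : IsCarlitzPeriod π) (hP : Irreducible P)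
    [(Ideal.span {P}).IsPrime] {n : ℕ} (hn : 0 < n) (hd : n ≤ Fintype.card F ^ P.natDegree)
    (j : ℕ) : (goss π n).coeff j ∈ localRing (Ideal.span {P}) := by
  rw [goss_eq_gossFormula hπ hn]
  refine coeff_gossFormula_mem (fun m hm => ?_) j
  rw [carlitzExpSeries, PowerSeries.coeff_mk]
  refine sum_mem fun i _ => ?_
  split_ifs with h
  · refine carlitzExpCoeff_mem_localRing hP ?_
    rw [← Nat.pow_lt_pow_iff_right (Fintype.one_lt_card (α := F)), ← h]
    omega
  · exact zero_mem _

theorem dvd_pow_card_pow_natDegree_sub (hP : Irreducible P) (a : F[X]) :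
    P ∣ a ^ Fintype.card F ^ P.natDegree - a := by
  set Q := Fintype.card F ^ P.natDegree with hQ
  have hX : P ∣ X ^ Q - X := by
    rw [hQ, ← Nat.card_eq_fintype_card]
    exact hP.natDegree_dvd_iff_dvd_X_pow_card_pow_sub_X.1 dvd_rfl
  induction a using Polynomial.induction_on' with
  | add a b ha hb =>
    rw [hQ, add_pow_card_pow_of_ringHom C, ← hQ, add_sub_add_comm]
    exact dvd_add ha hb
  | monomial n c =>
    have h : monomial n c ^ Q - monomial n c = C c * ((X ^ Q) ^ n - X ^ n) := by
      rw [← C_mul_X_pow_eq_monomial, mul_pow, ← C_pow, hQ, FiniteField.pow_card_pow, mul_sub,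
        pow_right_comm]
    rw [h]
    exact (hX.trans (sub_dvd_pow_sub_pow _ _ n)).mul_left _

/-- With `k = p^v m`, both terms are `q^ν p^v`-th powers, and this exponent is a power of `p`. The
difference is therefore that power of `(a^{q^d})^m - a^m`, which `P` divides. -/
theorem pow_sub_pow_mem_span_pow (p : ℕ) [CharP F p] (hP : Irreducible P) (k ν : ℕ) (a : F[X]) :
    a ^ (k * Fintype.card F ^ (P.natDegree + ν)) - a ^ (k * Fintype.card F ^ ν) ∈
      Ideal.span {P} ^ (Fintype.card F ^ ν * p ^ padicValNat p k) := by
  obtain ⟨r, hp, hr⟩ := FiniteField.card F p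
  have : Fact p.Prime := ⟨hp⟩
  obtain ⟨m, hm⟩ := pow_padicValNat_dvd (p := p) (n := k)
  set v := padicValNat p k
  have e : Fintype.card F ^ ν * p ^ v = p ^ (r * ν + v) := by rw [hr]; ring
  have h1 : a ^ (k * Fintype.card F ^ (P.natDegree + ν)) =
      ((a ^ Fintype.card F ^ P.natDegree) ^ m) ^ p ^ (r * ν + v) := by
    rw [← pow_mul, ← pow_mul, ← e, pow_add, hm]
    ring_nf
  have h2 : a ^ (k * Fintype.card F ^ ν) = (a ^ m) ^ p ^ (r * ν + v) := by
    rw [← pow_mul, ← e, hm]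
    ring_nf
  rw [h1, h2, ← sub_pow_char_pow, e, Ideal.span_singleton_pow, Ideal.mem_span_singleton]
  exact pow_dvd_pow_of_dvd
    ((dvd_pow_card_pow_natDegree_sub hP a).trans (sub_dvd_pow_sub_pow _ _ m)) _

end Integrality

end Drinfeld

/-! ### The `t`-expansions of `t_a` and of `G_n(t_a)` -/

namespace Drinfeld

variable {F : Type*} [Field F] [Fintype F]

theorem natDegree_carlitzTPow_le (i : ℕ) :
    (carlitzTPow F i).natDegree ≤ Fintype.card F ^ i := by
  induction i with
  | zero => simp [carlitzTPow]
  | succ i ih =>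
    refine natDegree_add_le_of_degree_le ((natDegree_C_mul_le _ _).trans ?_) ?_
    · exact ih.trans (Nat.pow_le_pow_right Fintype.card_pos i.le_succ)
    · rw [pow_succ']
      exact natDegree_pow_le_of_le _ ih

theorem coeff_carlitzTPow (i : ℕ) : (carlitzTPow F i).coeff (Fintype.card F ^ i) = 1 := by
  induction i with
  | zero => simp [carlitzTPow]
  | succ i ih =>
    have hlt : (carlitzTPow F i).natDegree < Fintype.card F ^ (i + 1) :=
      (natDegree_carlitzTPow_le i).trans_lt
        (Nat.pow_lt_pow_right Fintype.one_lt_card i.lt_succ_self)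
    rw [carlitzTPow, coeff_add, coeff_C_mul, coeff_eq_zero_of_natDegree_lt hlt, mul_zero, zero_add,
      pow_succ', coeff_pow_of_natDegree_le (natDegree_carlitzTPow_le i), ih, one_pow]

theorem coeff_carlitz {a : F[X]} (ha : a.Monic) :
    (carlitz a).coeff (Fintype.card F ^ a.natDegree) = 1 := by
  rw [carlitz, sum_def, finsetSum_coeff, Finset.sum_eq_single a.natDegree]
  · simp [ha.coeff_natDegree, coeff_carlitzTPow]
  · intro i hi hne
    have hlt : i < a.natDegree := lt_of_le_of_ne (le_natDegree_of_mem_supp i hi) hne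
    rw [coeff_C_mul, coeff_eq_zero_of_natDegree_lt ((natDegree_carlitzTPow_le i).trans_lt
      (Nat.pow_lt_pow_right Fintype.one_lt_card hlt)), mul_zero]
  · intro h
    simp [notMem_support_iff.1 h]

/-- The `t`-expansion of `t_a` has coefficients in `A`. -/
theorem exists_map_ofA_eq_tExp {a : F[X]} (ha : a.Monic) :
    ∃ f : PowerSeries F[X], PowerSeries.map (ofA F) f = tExp a := by
  set Q := Fintype.card F ^ a.natDegree with hQ
  set r : PowerSeries F[X] := (((carlitz a).reflect Q : F[X][X]) : PowerSeries F[X]) with hr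
  -- Reflection turns the leading coefficient of `ρ_a` into the constant term, so `r` is already
  -- invertible over `A`.
  have hr1 : PowerSeries.constantCoeff r = 1 := by
    rw [← PowerSeries.coeff_zero_eq_constantCoeff_apply, hr, Polynomial.coeff_coe, coeff_reflect,
      revAt_le (Nat.zero_le _), Nat.sub_zero, hQ, coeff_carlitz ha]
  have hmap : (((carlitzC a).reflect Q : (CInfty F)[X]) : PowerSeries (CInfty F)) =
      PowerSeries.map (ofA F) r := by
    rw [carlitzC, reflect_map, polynomial_map_coe]
  have hinv : PowerSeries.map (ofA F) (PowerSeries.invOfUnit r 1) =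
      (PowerSeries.map (ofA F) r)⁻¹ := by
    rw [PowerSeries.eq_inv_iff_mul_eq_one, ← map_mul, mul_comm,
      PowerSeries.mul_invOfUnit _ _ (by simpa using hr1), map_one]
    rw [← PowerSeries.coeff_zero_eq_constantCoeff_apply, PowerSeries.coeff_map,
      PowerSeries.coeff_zero_eq_constantCoeff_apply, hr1, map_one]
    exact one_ne_zero
  refine ⟨PowerSeries.X ^ Q * PowerSeries.invOfUnit r 1, ?_⟩
  rw [map_mul, map_pow, PowerSeries.map_X, hinv, tExp, ← hQ, hmap]

theorem coeff_aeval_tExp_mem_localRing {I : Ideal F[X]} [I.IsPrime] {G : (CInfty F)[X]}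
    (hG : ∀ j, G.coeff j ∈ localRing I) {a : F[X]} (ha : a.Monic) (m : ℕ) :
    PowerSeries.coeff m (aeval (tExp a) G) ∈ localRing I := by
  obtain ⟨f, hf⟩ := exists_map_ofA_eq_tExp ha
  rw [aeval_eq_sum_range, map_sum]
  refine sum_mem fun j _ => ?_
  rw [PowerSeries.coeff_smul, smul_eq_mul, ← hf, ← map_pow, PowerSeries.coeff_map]
  exact mul_mem (hG j) (ofA_mem_localPow_zero I _)

theorem coeff_aeval_tExp_eq_zero {G : (CInfty F)[X]} (hG : G.coeff 0 = 0) {a : F[X]} {m : ℕ}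
    (hm : m < Fintype.card F ^ a.natDegree) : PowerSeries.coeff m (aeval (tExp a) G) = 0 := by
  have h1 : aeval (tExp a) X ∣ aeval (tExp a) G := map_dvd _ (X_dvd_iff.2 hG)
  rw [aeval_X] at h1
  exact PowerSeries.X_pow_dvd_iff.1 ((Dvd.intro _ rfl).trans h1) m hm

/-- `t^{q^{deg a}}` divides `G(t_a)`, so only `a` of degree at most `m` contribute. Finiteness is
needed to subtract two `finsum`s termwise, as `finsum` is 0 on infinite support. -/
theorem finite_support_coeff_aeval_tExp {G : (CInfty F)[X]} (hG : G.coeff 0 = 0) (m : ℕ)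
    (e : ℕ) : (Function.support fun a : {a : F[X] // a.Monic} =>
      ofA F (a : F[X]) ^ e * PowerSeries.coeff m (aeval (tExp (a : F[X])) G)).Finite := by
  refine ((lowDeg F (m + 1)).finite_toSet.preimage Subtype.val_injective.injOn).subset ?_
  rintro ⟨a, ha⟩ h
  rw [Set.mem_preimage, Finset.mem_coe, mem_lowDeg, ← natDegree_lt_iff_degree_lt ha.ne_zero]
  by_contra! hle
  refine h ?_
  simp only
  rw [coeff_aeval_tExp_eq_zero hG, mul_zero]
  exact (Nat.lt_pow_self Fintype.one_lt_card).trans_le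
    (Nat.pow_le_pow_right Fintype.card_pos (m.le_succ.trans hle))

theorem finsum_mem_localPow {I : Ideal F[X]} [I.IsPrime] {N : ℕ} {ι : Type*} {f : ι → CInfty F}
    (hf : ∀ i, f i ∈ localPow I N) : ∑ᶠ i, f i ∈ localPow I N :=
  finsum_induction (· ∈ localPow I N) (by simpa using ofA_mem_localPow (zero_mem (I ^ N)))
    (fun _ _ => add_mem_localPow) hf

end Drinfeld

end

theorem mainTheorem5 {F : Type*} [Field F] [Fintype F] (p : ℕ) [CharP F p]
    (π : Drinfeld.CInfty F) (hπ : Drinfeld.IsCarlitzPeriod π)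
    (k n : ℕ) (hn : 0 < n) (hkn : 2 * n < k) (hq : (Fintype.card F - 1) ∣ (k - 2 * n))
    (hp : n ≤ p ^ padicValNat p (k - n))
    (P : F[X]) (hP : P.Monic) (hP' : Irreducible P)
    (hd : Real.logb (Fintype.card F) n < P.natDegree) (ν : ℕ) :
    Drinfeld.CongrMod (Ideal.span {P})
      (Fintype.card F ^ ν * p ^ padicValNat p (k - n))
      (Drinfeld.FSeries π k n (P.natDegree + ν)) (Drinfeld.FSeries π k n ν) := by
  have hprime : (Ideal.span {P}).IsPrime :=
    (Ideal.span_singleton_prime hP'.ne_zero).2 hP'.prime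
  have hd' : n ≤ Fintype.card F ^ P.natDegree := by
    rw [Real.logb_lt_iff_lt_rpow (by exact_mod_cast Fintype.one_lt_card) (by exact_mod_cast hn),
      Real.rpow_natCast] at hd
    exact_mod_cast hd.le
  have hG := Drinfeld.coeff_goss_mem_localRing hπ hP' hn hd'
  have hG0 : (Drinfeld.goss π n).coeff 0 = 0 := by
    rw [Drinfeld.goss_eq_gossFormula hπ hn, coeff_gossFormula_zero]
  intro m
  have hc : ∀ a : {a : F[X] // a.Monic},
      PowerSeries.coeff m (aeval (Drinfeld.tExp (a : F[X])) (Drinfeld.goss π n)) ∈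
        Drinfeld.localPow (Ideal.span {P}) 0 :=
    fun a => Drinfeld.coeff_aeval_tExp_mem_localRing hG a.2 m
  -- The weight `(k - n) q^l + n` minus `n` gives back the exponent `(k - n) q^l`.
  simp only [Drinfeld.FSeries, Drinfeld.fSeries, PowerSeries.coeff_mk, Nat.add_sub_cancel]
  refine ⟨Drinfeld.finsum_mem_localPow fun a => ?_, Drinfeld.finsum_mem_localPow fun a => ?_, ?_⟩
  · rw [← map_pow]
    exact Drinfeld.mul_mem_localPow (Drinfeld.ofA_mem_localPow_zero _ _) (hc a)
  · rw [← map_pow]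
    exact Drinfeld.mul_mem_localPow (Drinfeld.ofA_mem_localPow_zero _ _) (hc a)
  · rw [← finsum_sub_distrib (Drinfeld.finite_support_coeff_aeval_tExp hG0 m _)
      (Drinfeld.finite_support_coeff_aeval_tExp hG0 m _)]
    refine Drinfeld.finsum_mem_localPow fun a => ?_
    rw [← sub_mul, ← map_pow, ← map_pow, ← map_sub]
    exact Drinfeld.mul_mem_localPow (Drinfeld.ofA_mem_localPow
      (Drinfeld.pow_sub_pow_mem_span_pow p hP' (k - n) ν a)) (hc a)
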